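/- Let $n\ge 2$. An $n$-Lie algebra is a vector space $\mathfrak g$ with a skew-symmetric $n$-linear bracket $[\cdot,\dots,\cdot]$ satisfying $$[[x_1,\dots,x_n],y_2,\dots,y_n]=\sum_{i=1}^n[x_1,\dots,[x_i,y_2,\dots,y_n],\dots,x_n];$$ all $n$-Lie algebras here are finite-dimensional over $\mathbb C$. For subspaces $W_1,\dots,W_n$ write $[W_1,\dots,W_n]$ for the span of all $[w_1,\dots,w_n]$ with $w_i\in W_i$. An ideal is a subspace $I$ with $[I,\mathfrak g,\dots,\mathfrak g]\subseteq I$; it is solvable if $I^{(s)}=0$ for some $s\ge 0$, where $I^{(0)}=I$ and $I^{(s+1)}=[I^{(s)},\dots,I^{(s)}]$. The solvable radical $\mathfrak r$ is the largest solvable ideal. A subalgebra $A$ is abelian if $[A,\dots,A]=0$. The centralizer of a subspace $W$ is $C_{\mathfrak g}(W)=\{x\in\mathfrak g : [x,W,\mathfrak g,\dots,\mathfrak g]=0\}$. A metric $n$-Lie algebra $(\mathfrak g,B)$ is an $n$-Lie algebra with a non-degenerate symmetric bilinear form $B$ such that $B([x_1,\dots,x_{n-1},y_1],y_2)=-B([x_1,\dots,x_{n-1},y_2],y_1)$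 for all $x_i,y_1,y_2\in\mathfrak g$. Write $W^\perp=\{x\in\mathfrak g : B(w,x)=0 \text{ for all } w\in W\}$; $W$ is isotropic if $W\subseteq W^\perp$ and non-degenerate if $W\cap W^\perp=0$. An isomaximal ideal is an isotropic ideal not properly contained in any other isotropic ideal. $(\mathfrak g,B)$ is decomposable if $\mathfrak g=I\oplus J$ for nonzero non-degenerate ideals $I,J$, and indecomposable otherwise. **Theorem 3.4.** Let $(\mathfrak g,B)$ be a metric $n$-Lie algebra with solvable radical $\mathfrak r\neq 0$, and let $I$ be an isomaximal ideal. Then $$\mathfrak r\cap\mathfrak r^\perp\subseteq I\subseteq\mathfrak r.$$ If moreover $(\mathfrak g,B)$ is indecomposable, then: 1. $I^\perp\subseteq\mathfrak r$. 2. $I^\perp/I$ is an abelian subalgebra of $\mathfrak g/I$. 3. $I^\perp/I=[I^\perp/I,\,I^\perp/I,\,\mathfrak g/I,\dots,\mathfrak g/I]\oplus\bigl(C_{\mathfrak g/I}(I^\perp/I)\cap(I^\perp/I)\bigr)$. -/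

import Mathlib

/-- An `n`-Lie algebra structure on a complex vector space `g`: a skew-symmetric `n`-linear bracket
(over `ℂ`, skew-symmetric and alternating are the same) such that
`[[x₁, …, xₙ], y₂, …, yₙ] = ∑ᵢ [x₁, …, [xᵢ, y₂, …, yₙ], …, xₙ]`.
The identity is written with the slot of the inner bracket among the `y`'s being an arbitrary
position `j`; by skew-symmetry each position gives the same condition as the first one. -/
structure NLieAlgebra (n : ℕ) (g : Type*) [AddCommGroup g] [Module ℂ g] where
  /-- The bracket `[x₁, …, xₙ]`. -/
  bracket : g [⋀^Fin n]→ₗ[ℂ] g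
  /-- The generalized Jacobi (Filippov) identity. -/
  jacobi : ∀ (x y : Fin n → g) (j : Fin n),
    bracket (Function.update y j (bracket x)) =
      ∑ i, bracket (Function.update x i (bracket (Function.update y j (x i))))

namespace NLieAlgebra

variable {n : ℕ} {g : Type*} [AddCommGroup g] [Module ℂ g]

/-- `[W₁, …, Wₙ]`: the subspace spanned by all brackets `[x₁, …, xₙ]` with `xᵢ ∈ Wᵢ`. -/
def bracketSpan (L : NLieAlgebra n g) (W : Fin n → Submodule ℂ g) : Submodule ℂ g :=
  Submodule.span ℂ {z | ∃ x : Fin n → g, (∀ i, x i ∈ W i) ∧ L.bracket x = z}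

/-- `A` is a subalgebra: `[A, …, A] ⊆ A`. -/
def IsSubalgebra (L : NLieAlgebra n g) (A : Submodule ℂ g) : Prop :=
  ∀ x : Fin n → g, (∀ i, x i ∈ A) → L.bracket x ∈ A

/-- `I` is an ideal: a bracket with at least one entry in `I` lies in `I`. -/
def IsIdeal (L : NLieAlgebra n g) (I : Submodule ℂ g) : Prop :=
  ∀ x : Fin n → g, (∃ i, x i ∈ I) → L.bracket x ∈ I

/-- `A` is an abelian subalgebra: a subalgebra with `[A, …, A] = 0`. -/
def IsAbelianSubalgebra (L : NLieAlgebra n g) (A : Submodule ℂ g) : Prop :=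
  L.IsSubalgebra A ∧ L.bracketSpan (fun _ => A) = ⊥

/-- The derived series `I⁽⁰⁾ = I`, `I⁽ˢ⁺¹⁾ = [I⁽ˢ⁾, …, I⁽ˢ⁾]`. -/
def derivedSeries (L : NLieAlgebra n g) (I : Submodule ℂ g) : ℕ → Submodule ℂ g
  | 0 => I
  | s + 1 => L.bracketSpan (fun _ => derivedSeries L I s)

/-- `I` is a solvable ideal: an ideal with `I⁽ˢ⁾ = 0` for some `s`. -/
def IsSolvableIdeal (L : NLieAlgebra n g) (I : Submodule ℂ g) : Prop :=
  L.IsIdeal I ∧ ∃ s, L.derivedSeries I s = ⊥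

/-- The solvable radical: the sum of all solvable ideals. In finite dimension this is the largest
solvable ideal, since a sum of two solvable ideals is a solvable ideal. -/
def radical (L : NLieAlgebra n g) : Submodule ℂ g :=
  sSup {I | L.IsSolvableIdeal I}

/-- The centralizer `{x | [x, W, g, …, g] = 0}`: all brackets having `x` in one slot and an element
of `W` in another slot vanish. -/
def centralizer (L : NLieAlgebra n g) (W : Submodule ℂ g) : Submodule ℂ g where
  carrier := {x | ∀ (v : Fin n → g) (i j : Fin n), i ≠ j → v j ∈ W →
    L.bracket (Function.update v i x) = 0}
  zero_mem' := fun v i _ _ _ => L.bracket.map_update_zero v i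
  add_mem' := fun {x y} hx hy v i j hij hv => by
    rw [L.bracket.map_update_add, hx v i j hij hv, hy v i j hij hv, add_zero]
  smul_mem' := fun c x hx v i j hij hv => by
    rw [L.bracket.map_update_smul, hx v i j hij hv, smul_zero]

/-- Modulo an ideal `I`, the bracket depends only on the classes of its entries. -/
theorem bracket_sub_mem (L : NLieAlgebra n g) {I : Submodule ℂ g} (hI : L.IsIdeal I)
    (x y : Fin n → g) (h : ∀ i, x i - y i ∈ I) : L.bracket x - L.bracket y ∈ I := by
  classical
  have key : ∀ s : Finset (Fin n), L.bracket (s.piecewise x y) - L.bracket y ∈ I := by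
    intro s
    induction s using Finset.induction_on with
    | empty => simp
    | insert a s ha ih =>
      rw [Finset.piecewise_insert]
      have h1 : L.bracket (Function.update (s.piecewise x y) a (x a)) -
          L.bracket (s.piecewise x y) ∈ I := by
        have h2 : L.bracket (s.piecewise x y) =
            L.bracket (Function.update (s.piecewise x y) a (y a)) := by
          congr 1
          rw [eq_comm, Function.update_eq_self_iff]
          simp [ha]
        rw [h2, ← L.bracket.map_update_sub]
        exact hI _ ⟨a, by simpa using h a⟩
      simpa using I.add_mem h1 ih
  simpa using key Finset.univ

/-- The bracket of representatives represents the bracket in `g ⧸ I`. -/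
theorem mkQ_bracket_out (L : NLieAlgebra n g) {I : Submodule ℂ g} (hI : L.IsIdeal I)
    (v : Fin n → g ⧸ I) (x : Fin n → g) (h : ∀ i, I.mkQ (x i) = v i) :
    I.mkQ (L.bracket fun i => (v i).out) = I.mkQ (L.bracket x) := by
  rw [Submodule.mkQ_apply, Submodule.mkQ_apply, Submodule.Quotient.eq]
  refine L.bracket_sub_mem hI _ _ fun i => ?_
  rw [← Submodule.Quotient.eq, ← Submodule.mkQ_apply, ← Submodule.mkQ_apply, h i]
  exact Submodule.Quotient.mk_out (v i)

/-- The bracket on `g ⧸ I`, computed on representatives. -/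
noncomputable def quotientBracket (L : NLieAlgebra n g) (I : Submodule ℂ g) (hI : L.IsIdeal I) :
    (g ⧸ I) [⋀^Fin n]→ₗ[ℂ] (g ⧸ I) where
  toFun v := I.mkQ (L.bracket fun i => (v i).out)
  map_update_add' := by
    intro _ v i a b
    have hu : ∀ (w : g ⧸ I) (k : Fin n), I.mkQ
        (Function.update (fun i => (v i).out) i w.out k) = Function.update v i w k := by
      intro w k
      by_cases hk : k = i
      · subst hk; simp
      · simp [hk]
    rw [L.mkQ_bracket_out hI _ (Function.update (fun i => (v i).out) i (a.out + b.out)),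
      L.mkQ_bracket_out hI _ _ (hu a), L.mkQ_bracket_out hI _ _ (hu b),
      L.bracket.map_update_add, map_add]
    intro k
    by_cases hk : k = i
    · subst hk; simp
    · simp [hk]
  map_update_smul' := by
    intro _ v i c a
    have hu : ∀ (w : g ⧸ I) (k : Fin n), I.mkQ
        (Function.update (fun i => (v i).out) i w.out k) = Function.update v i w k := by
      intro w k
      by_cases hk : k = i
      · subst hk; simp
      · simp [hk]
    rw [L.mkQ_bracket_out hI _ (Function.update (fun i => (v i).out) i (c • a.out)),
      L.mkQ_bracket_out hI _ _ (hu a), L.bracket.map_update_smul, map_smul]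
    intro k
    by_cases hk : k = i
    · subst hk; simp
    · simp [hk]
  map_eq_zero_of_eq' := by
    intro v i j h hij
    rw [L.bracket.map_eq_zero_of_eq _ (by simp [h]) hij, map_zero]

theorem quotientBracket_mkQ (L : NLieAlgebra n g) (I : Submodule ℂ g) (hI : L.IsIdeal I)
    (x : Fin n → g) : L.quotientBracket I hI (fun i => I.mkQ (x i)) = I.mkQ (L.bracket x) :=
  L.mkQ_bracket_out hI _ x fun _ => rfl

/-- The quotient `n`-Lie algebra `g ⧸ I` of `g` by an ideal `I`, with
`[x₁ + I, …, xₙ + I] = [x₁, …, xₙ] + I`. -/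
noncomputable def quotient (L : NLieAlgebra n g) (I : Submodule ℂ g) (hI : L.IsIdeal I) :
    NLieAlgebra n (g ⧸ I) where
  bracket := L.quotientBracket I hI
  jacobi := by
    intro v w j
    obtain ⟨x, rfl⟩ : ∃ x : Fin n → g, (fun i => I.mkQ (x i)) = v :=
      ⟨fun i => (v i).out, by ext i; simp⟩
    obtain ⟨y, rfl⟩ : ∃ y : Fin n → g, (fun i => I.mkQ (y i)) = w :=
      ⟨fun i => (w i).out, by ext i; simp⟩
    have hu : ∀ (z : Fin n → g) (k : Fin n) (a : g),
        Function.update (fun i => I.mkQ (z i)) k (I.mkQ a) =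
          fun i => I.mkQ (Function.update z k a i) := by
      intro z k a
      ext i
      by_cases hk : i = k
      · subst hk; simp
      · simp [hk]
    simp only [quotientBracket_mkQ, hu, L.jacobi x y j, map_sum]

/-- `B` is a metric on the `n`-Lie algebra: a non-degenerate symmetric bilinear form with
`B([x₁, …, xₙ₋₁, y₁], y₂) = -B([x₁, …, xₙ₋₁, y₂], y₁)`. The invariance is written for `y₁`, `y₂` in
an arbitrary slot `i`; by skew-symmetry each slot gives the same condition as the last one. -/
structure IsMetric (L : NLieAlgebra n g) (B : LinearMap.BilinForm ℂ g) : Prop where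
  symm : B.IsSymm
  nondegenerate : B.Nondegenerate
  invariant : ∀ (x : Fin n → g) (i : Fin n) (y₁ y₂ : g),
    B (L.bracket (Function.update x i y₁)) y₂ = -B (L.bracket (Function.update x i y₂)) y₁

/-- `I` is an isotropic ideal: an ideal with `I ⊆ I^⊥`. -/
def IsIsotropicIdeal (L : NLieAlgebra n g) (B : LinearMap.BilinForm ℂ g) (I : Submodule ℂ g) :
    Prop :=
  L.IsIdeal I ∧ I ≤ B.orthogonal I

/-- `I` is an isomaximal ideal: it is maximal, for inclusion, among the isotropic ideals. -/
def IsIsomaximal (L : NLieAlgebra n g) (B : LinearMap.BilinForm ℂ g) (I : Submodule ℂ g) : Prop :=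
  Maximal (L.IsIsotropicIdeal B) I

/-- `(g, B)` is decomposable: `g = I ⊕ J` for nonzero ideals `I`, `J` that are non-degenerate, that
is `I ∩ I^⊥ = 0` and `J ∩ J^⊥ = 0`. -/
def IsDecomposable (L : NLieAlgebra n g) (B : LinearMap.BilinForm ℂ g) : Prop :=
  ∃ I J : Submodule ℂ g, L.IsIdeal I ∧ L.IsIdeal J ∧ I ≠ ⊥ ∧ J ≠ ⊥ ∧
    I ⊓ B.orthogonal I = ⊥ ∧ J ⊓ B.orthogonal J = ⊥ ∧ IsCompl I J

end NLieAlgebra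

/-
Isotropic ideals are abelian, so `I ⊆ r`, and `I + (r ∩ r^⊥)` is isotropic, so `r ∩ r^⊥ ⊆ I`.

The substantial point is that `r^⊥ ⊆ r` when `g` is indecomposable. The quotient `g / r` has zero
radical, and in an algebra with zero radical every minimal ideal `J` has an ideal complement: the
trace form is nondegenerate on the inner derivations with image in `J`, and the complement is the
kernel of the associated Casimir endomorphism. If `r^⊥ ⊄ r`, take `J` inside the image of `r^⊥` in
`g / r`; its complement pulls back to a proper ideal `T ⊇ r` with `T + r^⊥ = g`. Then
`T^⊥ ∩ r = 0`, whereas the isotropic ideal `T ∩ T^⊥` lies in `r`, so `T ∩ T^⊥ = 0` and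
`g = T ⊕ T^⊥`.

An ideal `W` with `I ⊆ W ⊆ I^⊥` satisfies `W ∩ W^⊥ = I` by maximality of `I`, hence
`W + W^⊥ = I^⊥`. Taking `W = I + (I^⊥)⁽ˢ⁾` shows, by descending along the derived series, that
`I^⊥ / I` is abelian. For `W = I + [I^⊥, I^⊥, g, …, g]` the image of `W^⊥` in `g / I` is the
centralizer of `I^⊥ / I` in `I^⊥ / I`, which gives the decomposition.
-/

section LinearAlgebra

theorem exists_lift_mkQ {R M : Type*} [Ring R] [AddCommGroup M] [Module R M] {ι : Type*}
    (I A : Submodule R M) (v : ι → M ⧸ I) :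
    ∃ x : ι → M, (fun i => I.mkQ (x i)) = v ∧ ∀ i, v i ∈ A.map I.mkQ → x i ∈ A := by
  have hlift (w : M ⧸ I) : ∃ a, I.mkQ a = w ∧ (w ∈ A.map I.mkQ → a ∈ A) := by
    by_cases hw : w ∈ A.map I.mkQ
    · obtain ⟨a, ha, haw⟩ := hw
      exact ⟨a, haw, fun _ => ha⟩
    · obtain ⟨a, ha⟩ := I.mkQ_surjective w
      exact ⟨a, ha, fun hw' => absurd hw' hw⟩
  choose f hf hfA using hlift
  exact ⟨fun i => f (v i), funext fun i => hf (v i), fun i => hfA (v i)⟩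

theorem disjoint_map_mkQ {R M : Type*} [Ring R] [AddCommGroup M] [Module R M]
    {I P Q : Submodule R M} (hQ : I ≤ Q) (hPQ : P ⊓ Q ≤ I) :
    Disjoint (P.map I.mkQ) (Q.map I.mkQ) := by
  rw [Submodule.disjoint_def]
  rintro _ ⟨p, hp, rfl⟩ hpQ
  rw [← Submodule.mem_comap, Submodule.comap_map_mkQ, sup_eq_right.mpr hQ] at hpQ
  exact (Submodule.Quotient.mk_eq_zero I).mpr (hPQ ⟨hp, hpQ⟩)

theorem orthogonal_sup {R M : Type*} [CommRing R] [AddCommGroup M] [Module R M]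
    (B : LinearMap.BilinForm R M) (P Q : Submodule R M) :
    B.orthogonal (P ⊔ Q) = B.orthogonal P ⊓ B.orthogonal Q := by
  refine le_antisymm (le_inf (LinearMap.BilinForm.orthogonal_le le_sup_left)
    (LinearMap.BilinForm.orthogonal_le le_sup_right)) fun v ⟨hP, hQ⟩ => ?_
  have hker : P ⊔ Q ≤ LinearMap.ker (B.flip v) := sup_le hP hQ
  exact hker

end LinearAlgebra

attribute [local instance 100] LieRing.ofAssociativeRing

section DualBasis

open Module

variable {ι K V W : Type*} [Fintype ι] [DecidableEq ι] [Field K] [AddCommGroup V] [Module K V]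
  [AddCommGroup W] [Module K W] {τ : LinearMap.BilinForm K V}

theorem sum_apply_dualBasis_smul (hτ : τ.Nondegenerate) (b : Basis ι K V) (v : V) :
    ∑ j, τ (τ.dualBasis hτ b j) v • b j = v := by
  have h := (τ.flip.dualBasis hτ.flip (τ.dualBasis hτ b)).sum_repr v
  simp only [LinearMap.BilinForm.dualBasis_repr_apply] at h
  rwa [LinearMap.BilinForm.dualBasis_flip_dualBasis] at h

theorem sum_apply_dualBasis_add_eq_zero (hτ : τ.Nondegenerate) (b : Basis ι K V)
    (β : V →ₗ[K] V →ₗ[K] W) {d : V →ₗ[K] V} (hd : ∀ x y, τ (d x) y = -τ x (d y)) :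
    ∑ i, (β (d (b i)) (τ.dualBasis hτ b i) + β (b i) (d (τ.dualBasis hτ b i))) = 0 := by
  have hleft (i : ι) : β (d (b i)) (τ.dualBasis hτ b i) =
      ∑ j, τ (τ.dualBasis hτ b j) (d (b i)) • β (b j) (τ.dualBasis hτ b i) := by
    conv_lhs => rw [← sum_apply_dualBasis_smul hτ b (d (b i))]
    simp only [map_sum, map_smul, LinearMap.sum_apply, LinearMap.smul_apply]
  have hright (i : ι) : β (b i) (d (τ.dualBasis hτ b i)) =
      ∑ j, -τ (τ.dualBasis hτ b i) (d (b j)) • β (b i) (τ.dualBasis hτ b j) := by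
    conv_lhs => rw [← (τ.dualBasis hτ b).sum_repr (d _)]
    simp only [map_sum, map_smul, LinearMap.BilinForm.dualBasis_repr_apply, hd]
  simp only [hleft, hright, Finset.sum_add_distrib]
  rw [Finset.sum_comm]
  simp only [neg_smul, Finset.sum_neg_distrib, add_neg_cancel]

end DualBasis

section LieModule

open LieAlgebra LieModule Module

theorem isIrreducible_of_isAtom {R L M : Type*} [CommRing R] [LieRing L] [AddCommGroup M]
    [Module R M] [LieRingModule L M] {J : LieSubmodule R L M} (hJ : IsAtom J) :
    IsIrreducible R L J := by
  have : Nontrivial J := (LieSubmodule.nontrivial_iff_ne_bot R L M).mpr hJ.ne_bot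
  refine IsIrreducible.mk fun N hN => ?_
  contrapose! hN
  have hlt : N.map J.incl < J := LieSubmodule.map_incl_lt_iff_lt_top.mpr (lt_top_iff_ne_top.mpr hN)
  refine (LieSubmodule.eq_bot_iff N).mpr fun m hm => ?_
  have hm' : (m : M) ∈ N.map J.incl := LieSubmodule.mem_map_of_mem (f := J.incl) hm
  simpa [hJ.lt_iff.mp hlt] using hm'

variable {K L M : Type*} [Field K] [LieRing L] [LieAlgebra K L] [AddCommGroup M] [Module K M]
  [LieRingModule L M] [LieModule K L M]

theorem mem_ker_quotient_iff {J : LieSubmodule K L M} {x : L} :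
    x ∈ LieModule.ker K L (M ⧸ J) ↔ ∀ m : M, ⁅x, m⁆ ∈ J := by
  refine (LieModule.mem_ker ..).trans ((Submodule.Quotient.mk_surjective _).forall.trans ?_)
  exact forall_congr' fun m => LieSubmodule.Quotient.mk_eq_zero (N := J)

section Casimir

variable {I : LieIdeal K L} [FiniteDimensional K I]

/-- The Casimir endomorphism of the Lie module `M`, for an ideal `I` on which the trace form is
nondegenerate, written in an arbitrarily chosen basis of `I` and its dual basis. It yields module
endomorphisms with a prescribed nonzero trace. -/
noncomputable def casimir (hI : (traceForm K I M).Nondegenerate) : End K M :=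
  ∑ i, toEnd K I M (finBasis K I i) *
    toEnd K I M ((traceForm K I M).dualBasis hI (finBasis K I) i)

variable (hI : (traceForm K I M).Nondegenerate)

theorem trace_casimir : LinearMap.trace K M (casimir hI) = finrank K I := by
  have htrace (i : Fin (finrank K I)) : LinearMap.trace K M (toEnd K I M (finBasis K I i) *
      toEnd K I M ((traceForm K I M).dualBasis hI (finBasis K I) i)) = 1 := by
    rw [LinearMap.trace_mul_comm]
    exact (LinearMap.BilinForm.apply_dualBasis_left hI (finBasis K I) i i).trans (if_pos rfl)
  rw [casimir, map_sum, Finset.sum_congr rfl fun i _ => htrace i]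
  simp

theorem lie_casimir (x : L) : ⁅toEnd K L M x, casimir hI⁆ = 0 := by
  have hφ (y : I) : toEnd K I M (toEnd K L I x y) = ⁅toEnd K L M x, toEnd K I M y⁆ :=
    LieHom.map_lie (toEnd K L M) x y
  have h := sum_apply_dualBasis_add_eq_zero hI (finBasis K I)
    ((LinearMap.mul K (End K M)).compl₁₂ (toEnd K I M : I →ₗ[K] End K M) (toEnd K I M))
    (d := toEnd K L I x) fun y z => traceForm_lieInvariant K L M x y z
  simp only [LinearMap.compl₁₂_apply, LinearMap.mul_apply', LieHom.coe_toLinearMap, hφ] at h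
  rw [casimir, lie_sum, ← h]
  exact Finset.sum_congr rfl fun i _ => by simp only [Ring.lie_def]; noncomm_ring

theorem casimir_apply_mem {J : LieSubmodule K L M} (hIJ : I ≤ LieModule.ker K L (M ⧸ J)) (m : M) :
    casimir hI m ∈ J := by
  rw [casimir, LinearMap.sum_apply]
  exact sum_mem fun i _ => mem_ker_quotient_iff.mp (hIJ (finBasis K I i).2) _

end Casimir

variable [CharZero K] [FiniteDimensional K M]

theorem exists_isCompl_of_nondegenerate_traceForm {I : LieIdeal K L} [FiniteDimensional K I]
    {J : LieSubmodule K L M} (hJ : IsAtom J) (hI : (traceForm K I M).Nondegenerate)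
    (hbot : I ≠ ⊥) (hIJ : I ≤ LieModule.ker K L (M ⧸ J)) :
    ∃ N : LieSubmodule K L M, IsCompl J N := by
  -- The complement is the kernel of the Casimir endomorphism: it commutes with `L`, maps `M` into
  -- `J`, and does not vanish on `J`, since otherwise it would square to zero and have trace zero.
  let Ω : M →ₗ⁅K, L⁆ M :=
    { casimir hI with
      map_lie' := fun {x m} =>
        (sub_eq_zero.mp (DFunLike.congr_fun (lie_casimir hI x) m)).symm }
  have hrange (m : M) : Ω m ∈ J := casimir_apply_mem hI hIJ m
  have hdisj : Disjoint J Ω.ker := by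
    refine hJ.not_le_iff_disjoint.mp fun hle => hbot ?_
    have hnil : IsNilpotent (casimir hI) := ⟨2, LinearMap.ext fun m => hle (hrange m)⟩
    have htrace := (LinearMap.isNilpotent_trace_of_isNilpotent hnil).eq_zero
    rw [trace_casimir, Nat.cast_eq_zero] at htrace
    exact I.toSubmodule_eq_bot.mp (Submodule.finrank_eq_zero.mp htrace)
  refine ⟨Ω.ker, LieSubmodule.isCompl_toSubmodule.mp ?_⟩
  rw [← LieSubmodule.disjoint_toSubmodule] at hdisj
  refine ⟨hdisj, codisjoint_iff.mpr (Submodule.eq_top_of_disjoint _ _ ?_ hdisj)⟩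
  rw [← (Ω : M →ₗ[K] M).finrank_range_add_finrank_ker]
  refine add_le_add (Submodule.finrank_mono ?_) le_rfl
  rintro _ ⟨m, rfl⟩
  exact hrange m

theorem exists_forall_lie_eq_smul_of_isIrreducible [IsIrreducible K L M]
    [IsTriangularizable K L M] (A : LieIdeal K L) [IsSolvable A] :
    ∃ χ : A → K, ∀ (x : A) (m : M), ⁅x, m⁆ = χ x • m := by
  have := nontrivial_of_isIrreducible K L M
  obtain ⟨χ, hχ⟩ := exists_nontrivial_weightSpace_of_isSolvable K A M
  have : Nontrivial (weightSpaceOfIsLieTower K M χ : LieSubmodule K L M) := hχ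
  refine ⟨χ, fun x m => ?_⟩
  have hm : m ∈ (weightSpaceOfIsLieTower K M χ : LieSubmodule K L M) := by
    rw [LieSubmodule.eq_top_of_isIrreducible K L M (weightSpaceOfIsLieTower K M χ)]
    exact LieSubmodule.mem_top m
  exact (mem_weightSpace _ _).mp hm x

variable (K L M) in
theorem isSolvable_of_traceForm_eq_zero [FiniteDimensional K L] [IsFaithful K L M]
    (h : traceForm K L M = 0) : IsSolvable L := by
  set D : LieIdeal K L := derivedSeries K L 1
  have hnil (x : D) : IsNilpotent (toEnd K L M x) :=
    (LieModule.isNilpotent_iff_forall' (R := K)).mp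
      (isNilpotent_derivedSeries_of_traceForm_eq_zero h) x
  have : LieRing.IsNilpotent D := by
    rw [LieAlgebra.isNilpotent_iff_forall (R := K)]
    intro x
    refine (D : LieSubalgebra K L).isNilpotent_ad_of_isNilpotent_ad (x := x) ?_
    obtain ⟨k, hk⟩ := LieAlgebra.ad_nilpotent_of_nilpotent (R := K) (hnil x)
    refine ⟨k, LinearMap.ext fun y => IsFaithful.injective_toEnd (R := K) (M := M) ?_⟩
    have hcomm : Function.Semiconj (toEnd K L M) (ad K L x) (ad K (End K M) (toEnd K L M x)) :=
      fun z => by simp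
    rw [Module.End.pow_apply, (hcomm.iterate_right k) y, ← Module.End.pow_apply, hk]
    simp
  obtain ⟨k, hk⟩ := IsSolvable.solvable K D
  refine IsSolvable.mk (R := K) (k := k + 1) ?_
  rwa [derivedSeries_def, derivedSeriesOfIdeal_add, ← LieIdeal.derivedSeries_eq_bot_iff]

variable [FiniteDimensional K L] [IsFaithful K L M]

variable (M) in
theorem isSolvable_inf_orthogonal_traceForm (I : LieIdeal K L) :
    IsSolvable ↥(I ⊓ InvariantForm.orthogonal (traceForm K L M)
      (traceForm_lieInvariant K L M) I) := by
  set A := I ⊓ InvariantForm.orthogonal (traceForm K L M) (traceForm_lieInvariant K L M) I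
  have : IsFaithful K A M := inferInstanceAs (IsFaithful K (A : LieSubalgebra K L) M)
  refine isSolvable_of_traceForm_eq_zero K A M ?_
  ext ⟨x, hx⟩ ⟨y, hy⟩
  exact (InvariantForm.mem_orthogonal _ _ _ _).mp hy.2 x hx.1

variable (M) in
theorem nondegenerate_traceForm_of_forall_isSolvable {I : LieIdeal K L}
    (hI : ∀ A : LieIdeal K L, A ≤ I → IsSolvable A → A = ⊥) :
    (traceForm K I M).Nondegenerate := by
  refine (traceForm K L M).nondegenerate_restrict_of_disjoint_orthogonal
    (traceForm_isSymm K L M).isRefl (W := I.toSubmodule) ?_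
  have hbot := hI _ inf_le_left (isSolvable_inf_orthogonal_traceForm M I)
  rw [disjoint_iff, ← LieSubmodule.bot_toSubmodule (L := L), ← hbot]
  rfl

end LieModule

namespace NLieAlgebra

variable {n : ℕ} {g : Type*} [AddCommGroup g] [Module ℂ g] {L : NLieAlgebra n g}

section Ideals

/-- The inner derivation `v ↦ [x₁, …, v, …, xₙ]`, with `v` in slot `i`. The entry `x i` is
irrelevant. -/
noncomputable def ad (L : NLieAlgebra n g) (x : Fin n → g) (i : Fin n) : Module.End ℂ g :=
  L.bracket.toMultilinearMap.toLinearMap x i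

theorem ad_apply (x : Fin n → g) (i : Fin n) (v : g) :
    L.ad x i v = L.bracket (Function.update x i v) := rfl

theorem ad_apply_self (x : Fin n → g) (i : Fin n) : L.ad x i (x i) = L.bracket x := by
  rw [ad_apply, Function.update_eq_self]

theorem ad_update_zero (x : Fin n → g) {i k : Fin n} (h : k ≠ i) :
    L.ad (Function.update x k 0) i = 0 :=
  LinearMap.ext fun v => L.bracket.map_coord_zero k (by simp [h])

theorem isIdeal_iff_ad {I : Submodule ℂ g} :
    L.IsIdeal I ↔ ∀ x i, I ≤ I.comap (L.ad x i) := by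
  refine ⟨fun h x i v hv => h _ ⟨i, by simpa using hv⟩, fun h x ⟨i, hi⟩ => ?_⟩
  rw [← ad_apply_self x i]
  exact h x i hi

theorem isIdeal_top : L.IsIdeal ⊤ := fun _ _ => trivial

theorem isIdeal_sSup {S : Set (Submodule ℂ g)} (hS : ∀ I ∈ S, L.IsIdeal I) :
    L.IsIdeal (sSup S) :=
  isIdeal_iff_ad.mpr fun x i => sSup_le fun I hI =>
    (isIdeal_iff_ad.mp (hS I hI) x i).trans (Submodule.comap_mono (le_sSup hI))

theorem IsIdeal.sup {I J : Submodule ℂ g} (hI : L.IsIdeal I) (hJ : L.IsIdeal J) :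
    L.IsIdeal (I ⊔ J) :=
  sSup_pair (a := I) ▸ isIdeal_sSup (by simp [hI, hJ])

theorem IsIdeal.inf {I J : Submodule ℂ g} (hI : L.IsIdeal I) (hJ : L.IsIdeal J) :
    L.IsIdeal (I ⊓ J) :=
  fun x ⟨i, hi⟩ => ⟨hI x ⟨i, hi.1⟩, hJ x ⟨i, hi.2⟩⟩

theorem IsIdeal.ad_apply_mem_of_forall_mem (hn : 2 ≤ n) {J : Submodule ℂ g} (hJ : L.IsIdeal J)
    {x : Fin n → g} (hx : ∀ k, x k ∈ J) (i : Fin n) (v : g) : L.ad x i v ∈ J := by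
  have : Nontrivial (Fin n) := Fin.nontrivial_iff_two_le.mpr hn
  obtain ⟨k, hk⟩ := exists_ne i
  exact hJ _ ⟨k, by simpa [hk] using hx k⟩

end Ideals

section BracketSpan

variable {W : Fin n → Submodule ℂ g}

theorem bracket_mem_bracketSpan {x : Fin n → g} (hx : ∀ i, x i ∈ W i) :
    L.bracket x ∈ L.bracketSpan W :=
  Submodule.subset_span ⟨x, hx, rfl⟩

theorem bracketSpan_le {A : Submodule ℂ g} :
    L.bracketSpan W ≤ A ↔ ∀ x : Fin n → g, (∀ i, x i ∈ W i) → L.bracket x ∈ A := by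
  refine ⟨fun h x hx => h (bracket_mem_bracketSpan hx), fun h => Submodule.span_le.mpr ?_⟩
  rintro _ ⟨x, hx, rfl⟩
  exact h x hx

theorem bracketSpan_mono {W' : Fin n → Submodule ℂ g} (h : ∀ i, W i ≤ W' i) :
    L.bracketSpan W ≤ L.bracketSpan W' :=
  bracketSpan_le.mpr fun _ hx => bracket_mem_bracketSpan fun i => h i (hx i)

theorem IsIdeal.bracketSpan_le {I : Submodule ℂ g} (hI : L.IsIdeal I) (i : Fin n) (hi : W i ≤ I) :
    L.bracketSpan W ≤ I :=
  NLieAlgebra.bracketSpan_le.mpr fun x hx => hI x ⟨i, hi (hx i)⟩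

theorem isIdeal_bracketSpan (hW : ∀ i, L.IsIdeal (W i)) : L.IsIdeal (L.bracketSpan W) := by
  refine isIdeal_iff_ad.mpr fun y j => bracketSpan_le.mpr fun x hx => ?_
  rw [Submodule.mem_comap, ad_apply, L.jacobi]
  refine sum_mem fun i _ => bracket_mem_bracketSpan fun k => ?_
  obtain rfl | hk := eq_or_ne k i
  · rw [Function.update_self]
    exact isIdeal_iff_ad.mp (hW k) y j (hx k)
  · rw [Function.update_of_ne hk]
    exact hx k

end BracketSpan

section InnerDerivations

/-- `D` is a derivation of the `n`-Lie algebra. The Jacobi identity says that every `L.ad x i` is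
one. -/
def IsDerivation (L : NLieAlgebra n g) (D : Module.End ℂ g) : Prop :=
  ∀ x : Fin n → g, D (L.bracket x) = ∑ i, L.bracket (Function.update x i (D (x i)))

theorem IsDerivation.lie_ad {D : Module.End ℂ g} (hD : L.IsDerivation D)
    (x : Fin n → g) (i : Fin n) :
    ⁅D, L.ad x i⁆ = ∑ k ∈ Finset.univ.erase i, L.ad (Function.update x k (D (x k))) i := by
  ext v
  rw [Ring.lie_def, LinearMap.sub_apply, Module.End.mul_apply, Module.End.mul_apply, ad_apply,
    hD, ← Finset.add_sum_erase _ _ (Finset.mem_univ i), LinearMap.sum_apply, ad_apply]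
  simp only [Function.update_self, Function.update_idem, add_sub_cancel_left]
  refine Finset.sum_congr rfl fun k hk => ?_
  have hki : k ≠ i := Finset.ne_of_mem_erase hk
  rw [ad_apply, Function.update_of_ne hki, Function.update_comm hki]

theorem IsDerivation.lie_ad_eq_zero {D : Module.End ℂ g} (hD : L.IsDerivation D) {x : Fin n → g}
    (hx : ∀ k, D (x k) = 0) (i : Fin n) : ⁅D, L.ad x i⁆ = 0 := by
  rw [hD.lie_ad]
  refine Finset.sum_eq_zero fun k hk => ?_
  rw [hx, ad_update_zero x (Finset.ne_of_mem_erase hk)]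

theorem isDerivation_of_mem_span {a : Module.End ℂ g}
    (ha : a ∈ Submodule.span ℂ (Set.range (Function.uncurry L.ad))) : L.IsDerivation a := by
  induction ha using Submodule.span_induction with
  | mem a h => obtain ⟨⟨y, j⟩, rfl⟩ := h; exact fun x => L.jacobi x y j
  | zero => intro x; simp
  | add a b _ _ ha hb => intro x; simp [ha x, hb x, Finset.sum_add_distrib]
  | smul c a _ ha => intro x; simp [ha x, Finset.smul_sum]

/-- The Lie algebra of inner derivations, spanned by the `L.ad x i`. Its Lie submodules in `g` are
the ideals of the `n`-Lie algebra. -/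
noncomputable def innerDerivations (L : NLieAlgebra n g) : LieSubalgebra ℂ (Module.End ℂ g) where
  toSubmodule := Submodule.span ℂ (Set.range (Function.uncurry L.ad))
  lie_mem' {a b} ha hb := by
    have had := isDerivation_of_mem_span ha
    induction hb using Submodule.span_induction with
    | mem b h =>
      obtain ⟨⟨x, i⟩, rfl⟩ := h
      rw [Function.uncurry_apply_pair, had.lie_ad]
      exact sum_mem fun k _ => Submodule.subset_span (Set.mem_range_self (_, _))
    | zero => simp
    | add b c _ _ hb hc => rw [lie_add]; exact Submodule.add_mem _ hb hc
    | smul r b _ hb => rw [lie_smul]; exact Submodule.smul_mem _ r hb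

theorem isDerivation_coe (a : L.innerDerivations) : L.IsDerivation a :=
  isDerivation_of_mem_span a.2

theorem ad_mem_innerDerivations (x : Fin n → g) (i : Fin n) : L.ad x i ∈ L.innerDerivations :=
  Submodule.subset_span ⟨(x, i), rfl⟩

theorem isIdeal_coe (N : LieSubmodule ℂ L.innerDerivations g) : L.IsIdeal N :=
  isIdeal_iff_ad.mpr fun x i _ hv => N.lie_mem (x := ⟨_, ad_mem_innerDerivations x i⟩) hv

/-- An ideal of the `n`-Lie algebra as a Lie submodule over the inner derivations. -/
def IsIdeal.toLieSubmodule {I : Submodule ℂ g} (hI : L.IsIdeal I) :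
    LieSubmodule ℂ L.innerDerivations g where
  toSubmodule := I
  lie_mem {a v} hv := by
    obtain ⟨a, ha⟩ := a
    change a v ∈ I
    induction ha using Submodule.span_induction with
    | mem a h => obtain ⟨⟨x, i⟩, rfl⟩ := h; exact isIdeal_iff_ad.mp hI x i hv
    | zero => exact I.zero_mem
    | add a b _ _ ha hb => exact I.add_mem ha hb
    | smul c a _ ha => exact I.smul_mem c ha

end InnerDerivations

section Semisimple

open LieAlgebra

theorem eq_bot_of_bracketSpan_eq_bot (hL : L.radical = ⊥) {A : Submodule ℂ g} (hA : L.IsIdeal A)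
    (h : L.bracketSpan (fun _ => A) = ⊥) : A = ⊥ :=
  le_bot_iff.mp (hL ▸ le_sSup ⟨hA, 1, h⟩)

variable {J : LieSubmodule ℂ L.innerDerivations g}

theorem bracketSpan_eq_self_of_isAtom (hn : 0 < n) (hL : L.radical = ⊥) (hJ : IsAtom J) :
    L.bracketSpan (fun _ => (J : Submodule ℂ g)) = J := by
  have hid := isIdeal_coe J
  have hle : (isIdeal_bracketSpan fun _ : Fin n => hid).toLieSubmodule ≤ J :=
    hid.bracketSpan_le ⟨0, hn⟩ le_rfl
  obtain h | h := hJ.le_iff.mp hle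
  · have hbot := eq_bot_of_bracketSpan_eq_bot hL hid (congrArg LieSubmodule.toSubmodule h)
    exact absurd (J.toSubmodule_eq_bot.mp hbot) hJ.ne_bot
  · exact congrArg LieSubmodule.toSubmodule h

theorem IsDerivation.eq_zero_of_eq_smul (hn : n ≠ 1) {D : Module.End ℂ g} (hD : L.IsDerivation D)
    {A : Submodule ℂ g} (hA : A ≤ L.bracketSpan fun _ => A) {c : ℂ} (hc : ∀ v ∈ A, D v = c • v) :
    ∀ v ∈ A, D v = 0 := by
  have hspan : L.bracketSpan (fun _ => A) ≤ Module.End.eigenspace D (n * c) := by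
    refine bracketSpan_le.mpr fun x hx => Module.End.mem_eigenspace_iff.mpr ?_
    have hterm (i : Fin n) : L.bracket (Function.update x i (D (x i))) = c • L.bracket x := by
      rw [hc _ (hx i), L.bracket.map_update_smul, Function.update_eq_self]
    simp [hD x, hterm, mul_smul, Nat.cast_smul_eq_nsmul]
  intro v hv
  have hmul : (n * c) • v = c • v :=
    (Module.End.mem_eigenspace_iff.mp (hspan (hA hv))).symm.trans (hc v hv)
  have hn' : (n : ℂ) - 1 ≠ 0 := sub_ne_zero.mpr (mod_cast hn)
  rw [hc v hv]
  refine (smul_eq_zero.mp ?_).resolve_left hn'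
  rw [sub_smul, one_smul, ← mul_smul, hmul, sub_self]

theorem eq_bot_of_forall_lie_eq_zero (hn : 2 ≤ n) (hJ : IsAtom J)
    (hperf : L.bracketSpan (fun _ => (J : Submodule ℂ g)) = J)
    {A : LieIdeal ℂ L.innerDerivations} (hA : A ≤ LieModule.ker ℂ L.innerDerivations (g ⧸ J))
    (h : ∀ a ∈ A, ∀ v ∈ J, ⁅a, v⁆ = 0) : A = ⊥ := by
  -- The submodule `⁅A, ⊤⁆` lies in `J`. It is not `J`, because `ad x i` with entries of `x` in `J`
  -- commutes with `A` and hence annihilates `⁅A, ⊤⁆`.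
  have hker {x : Fin n → g} (hx : ∀ k, x k ∈ J) (i : Fin n) :
      ⁅A, (⊤ : LieSubmodule ℂ L.innerDerivations g)⁆.toSubmodule ≤ LinearMap.ker (L.ad x i) := by
    rw [LieSubmodule.lieIdeal_oper_eq_linear_span, Submodule.span_le]
    rintro _ ⟨⟨a, ha⟩, ⟨v, -⟩, rfl⟩
    have hcomm := (isDerivation_coe a).lie_ad_eq_zero (fun k => h a ha _ (hx k)) i
    rw [Ring.lie_def, sub_eq_zero] at hcomm
    exact (LinearMap.congr_fun hcomm v).symm.trans
      (h a ha _ ((isIdeal_coe J).ad_apply_mem_of_forall_mem hn hx i v))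
  have hle : ⁅A, (⊤ : LieSubmodule ℂ L.innerDerivations g)⁆ ≤ J :=
    (LieSubmodule.lie_le_iff _ _ _).mpr fun _ ha v _ => mem_ker_quotient_iff.mp (hA ha) v
  obtain hbot | htop := hJ.le_iff.mp hle
  · refine (LieSubmodule.eq_bot_iff A).mpr fun a ha =>
      LieModule.ext_of_isFaithful (R := ℂ) g fun v => ?_
    rw [zero_lie, ← LieSubmodule.mem_bot (R := ℂ) (L := L.innerDerivations), ← hbot]
    exact LieSubmodule.lie_mem_lie ha (LieSubmodule.mem_top v)
  · refine absurd (J.toSubmodule_eq_bot.mp ?_) hJ.ne_bot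
    rw [← hperf, eq_bot_iff]
    refine bracketSpan_le.mpr fun x hx => ?_
    rw [Submodule.mem_bot, ← ad_apply_self x ⟨0, by omega⟩]
    exact hker hx _ (htop ▸ hx _)

theorem ker_quotient_ne_bot (hn : 2 ≤ n) (hJ : J ≠ ⊥)
    (hperf : L.bracketSpan (fun _ => (J : Submodule ℂ g)) = J) :
    LieModule.ker ℂ L.innerDerivations (g ⧸ J) ≠ ⊥ := by
  refine fun hker => hJ (J.toSubmodule_eq_bot.mp ?_)
  rw [← hperf, eq_bot_iff]
  refine bracketSpan_le.mpr fun x hx => ?_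
  let i : Fin n := ⟨0, by omega⟩
  have hmem : ⟨L.ad x i, ad_mem_innerDerivations x i⟩ ∈
      LieModule.ker ℂ L.innerDerivations (g ⧸ J) :=
    mem_ker_quotient_iff.mpr ((isIdeal_coe J).ad_apply_mem_of_forall_mem hn hx i)
  rw [hker, LieSubmodule.mem_bot, Subtype.ext_iff] at hmem
  rw [Submodule.mem_bot, ← ad_apply_self x i]
  exact LinearMap.congr_fun hmem _

variable [FiniteDimensional ℂ g]

theorem lie_eq_zero_of_isSolvable (hn : n ≠ 1) (hJ : IsAtom J)
    (hperf : L.bracketSpan (fun _ => (J : Submodule ℂ g)) = J)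
    {A : LieIdeal ℂ L.innerDerivations} [IsSolvable A] {a : L.innerDerivations} (ha : a ∈ A)
    {v : g} (hv : v ∈ J) : ⁅a, v⁆ = 0 := by
  have := isIrreducible_of_isAtom hJ
  obtain ⟨χ, hχ⟩ := exists_forall_lie_eq_smul_of_isIrreducible (M := J) A
  exact (isDerivation_coe a).eq_zero_of_eq_smul hn hperf.ge (c := χ ⟨a, ha⟩)
    (fun w hw => congrArg Subtype.val (hχ ⟨a, ha⟩ ⟨w, hw⟩)) v hv

theorem eq_bot_of_isSolvable_of_le_ker (hn : 2 ≤ n) (hJ : IsAtom J)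
    (hperf : L.bracketSpan (fun _ => (J : Submodule ℂ g)) = J)
    {A : LieIdeal ℂ L.innerDerivations} (hA : A ≤ LieModule.ker ℂ L.innerDerivations (g ⧸ J))
    [IsSolvable A] : A = ⊥ :=
  eq_bot_of_forall_lie_eq_zero hn hJ hperf hA fun _ ha _ hv =>
    lie_eq_zero_of_isSolvable (by omega) hJ hperf ha hv

theorem exists_isCompl_of_isAtom (hn : 2 ≤ n) (hL : L.radical = ⊥) (hJ : IsAtom J) :
    ∃ N : LieSubmodule ℂ L.innerDerivations g, IsCompl J N := by
  have hperf := bracketSpan_eq_self_of_isAtom (by omega) hL hJ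
  refine exists_isCompl_of_nondegenerate_traceForm hJ ?_
    (ker_quotient_ne_bot hn hJ.ne_bot hperf) le_rfl
  exact nondegenerate_traceForm_of_forall_isSolvable g fun A hA _ =>
    eq_bot_of_isSolvable_of_le_ker hn hJ hperf hA

end Semisimple

section Solvable

variable {I J : Submodule ℂ g}

theorem isIdeal_radical : L.IsIdeal L.radical := isIdeal_sSup fun _ h => h.1

theorem isIdeal_derivedSeries (hI : L.IsIdeal I) (s : ℕ) : L.IsIdeal (L.derivedSeries I s) := by
  induction s with
  | zero => exact hI
  | succ s ih => exact isIdeal_bracketSpan fun _ => ih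

theorem derivedSeries_antitone (hn : 0 < n) (hI : L.IsIdeal I) : Antitone (L.derivedSeries I) :=
  antitone_nat_of_succ_le fun s => (isIdeal_derivedSeries hI s).bracketSpan_le ⟨0, hn⟩ le_rfl

theorem derivedSeries_mono (h : I ≤ J) (s : ℕ) : L.derivedSeries I s ≤ L.derivedSeries J s := by
  induction s with
  | zero => exact h
  | succ s ih => exact bracketSpan_mono fun _ => ih

theorem derivedSeries_add (I : Submodule ℂ g) (s t : ℕ) :
    L.derivedSeries I (s + t) = L.derivedSeries (L.derivedSeries I s) t := by
  induction t with
  | zero => rfl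
  | succ t ih => rw [← Nat.add_assoc, derivedSeries, derivedSeries, ih]

theorem isSolvableIdeal_bot : L.IsSolvableIdeal ⊥ :=
  ⟨fun _ ⟨i, hi⟩ => L.bracket.map_coord_zero i hi, 0, rfl⟩

end Solvable

section Quotient

variable {I A : Submodule ℂ g} {hI : L.IsIdeal I}

theorem quotient_bracket_mkQ (x : Fin n → g) :
    (L.quotient I hI).bracket (fun i => I.mkQ (x i)) = I.mkQ (L.bracket x) :=
  L.quotientBracket_mkQ I hI x

theorem quotient_ad_mkQ (x : Fin n → g) (i : Fin n) (v : g) :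
    (L.quotient I hI).ad (fun k => I.mkQ (x k)) i (I.mkQ v) = I.mkQ (L.ad x i v) := by
  rw [ad_apply, ad_apply, ← quotient_bracket_mkQ (hI := hI)]
  exact congrArg _ (Function.comp_update I.mkQ x i v).symm

theorem IsIdeal.map_mkQ (hI : L.IsIdeal I) (hA : L.IsIdeal A) :
    (L.quotient I hI).IsIdeal (A.map I.mkQ) := by
  rintro v ⟨i, hi⟩
  obtain ⟨x, rfl, hx⟩ := exists_lift_mkQ I A v
  rw [quotient_bracket_mkQ]
  exact Submodule.mem_map_of_mem (hA x ⟨i, hx i hi⟩)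

theorem IsIdeal.comap_mkQ (hI : L.IsIdeal I) {K : Submodule ℂ (g ⧸ I)}
    (hK : (L.quotient I hI).IsIdeal K) : L.IsIdeal (K.comap I.mkQ) := by
  rintro x ⟨i, hi⟩
  rw [Submodule.mem_comap, ← quotient_bracket_mkQ (hI := hI)]
  exact hK _ ⟨i, hi⟩

theorem bracketSpan_map_mkQ (W : Fin n → Submodule ℂ g) :
    (L.quotient I hI).bracketSpan (fun i => (W i).map I.mkQ) = (L.bracketSpan W).map I.mkQ := by
  refine le_antisymm (bracketSpan_le.mpr fun v hv => ?_) ?_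
  · choose x hx hxv using hv
    obtain rfl : (fun i => I.mkQ (x i)) = v := funext hxv
    rw [quotient_bracket_mkQ]
    exact Submodule.mem_map_of_mem (bracket_mem_bracketSpan hx)
  · refine Submodule.map_le_iff_le_comap.mpr (bracketSpan_le.mpr fun x hx => ?_)
    rw [Submodule.mem_comap, ← quotient_bracket_mkQ (hI := hI)]
    exact bracket_mem_bracketSpan fun i => Submodule.mem_map_of_mem (hx i)

theorem bracketSpan_sup_le (hI : L.IsIdeal I) (W : Fin n → Submodule ℂ g) :
    L.bracketSpan (fun i => W i ⊔ I) ≤ L.bracketSpan W ⊔ I := by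
  rw [sup_comm, ← Submodule.comap_map_mkQ, ← Submodule.map_le_iff_le_comap,
    ← bracketSpan_map_mkQ (hI := hI), ← bracketSpan_map_mkQ (hI := hI)]
  simp only [Submodule.map_sup, Submodule.mkQ_map_self, sup_bot_eq, le_refl]

theorem derivedSeries_map_mkQ (A : Submodule ℂ g) (s : ℕ) :
    (L.quotient I hI).derivedSeries (A.map I.mkQ) s = (L.derivedSeries A s).map I.mkQ := by
  induction s with
  | zero => rfl
  | succ s ih => rw [derivedSeries, derivedSeries, ih, bracketSpan_map_mkQ]

theorem mkQ_mem_centralizer_iff {x : g} :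
    I.mkQ x ∈ (L.quotient I hI).centralizer (A.map I.mkQ) ↔
      ∀ (y : Fin n → g) (i j : Fin n), i ≠ j → y j ∈ A → L.ad y i x ∈ I := by
  refine ⟨fun hx y i j hij hy => ?_, fun hx v i j hij hv => ?_⟩
  · rw [← Submodule.Quotient.mk_eq_zero I, ← Submodule.mkQ_apply, ← quotient_ad_mkQ (hI := hI)]
    exact hx _ i j hij (Submodule.mem_map_of_mem hy)
  · obtain ⟨y, rfl, hy⟩ := exists_lift_mkQ I A v
    rw [← ad_apply, quotient_ad_mkQ, Submodule.mkQ_apply, Submodule.Quotient.mk_eq_zero]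
    exact hx y i j hij (hy j hv)

end Quotient

section Radical

theorem IsSolvableIdeal.comap_mkQ {I : Submodule ℂ g} (hI : L.IsSolvableIdeal I)
    {S : Submodule ℂ (g ⧸ I)} (hS : (L.quotient I hI.1).IsSolvableIdeal S) :
    L.IsSolvableIdeal (S.comap I.mkQ) := by
  obtain ⟨t, ht⟩ := hI.2
  obtain ⟨hS, s, hs⟩ := hS
  refine ⟨hI.1.comap_mkQ hS, s + t, ?_⟩
  rw [← Submodule.map_comap_eq_of_surjective I.mkQ_surjective S, derivedSeries_map_mkQ,
    ← le_bot_iff, Submodule.map_le_iff_le_comap, Submodule.comap_bot, Submodule.ker_mkQ] at hs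
  rw [derivedSeries_add, eq_bot_iff, ← ht]
  exact derivedSeries_mono hs t

theorem IsSolvableIdeal.map_mkQ {I J : Submodule ℂ g} {hI : L.IsIdeal I}
    (hJ : L.IsSolvableIdeal J) : (L.quotient I hI).IsSolvableIdeal (J.map I.mkQ) := by
  obtain ⟨hJ, s, hs⟩ := hJ
  exact ⟨hI.map_mkQ hJ, s, by rw [derivedSeries_map_mkQ, hs, Submodule.map_bot]⟩

theorem IsSolvableIdeal.sup {I J : Submodule ℂ g} (hI : L.IsSolvableIdeal I)
    (hJ : L.IsSolvableIdeal J) : L.IsSolvableIdeal (I ⊔ J) := by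
  rw [← Submodule.comap_map_mkQ]
  exact hI.comap_mkQ hJ.map_mkQ

variable [FiniteDimensional ℂ g]

theorem isSolvableIdeal_radical : L.IsSolvableIdeal L.radical := by
  obtain ⟨M, hM⟩ := exists_maximal_of_wellFoundedGT L.IsSolvableIdeal ⟨⊥, isSolvableIdeal_bot⟩
  have hradical : L.radical = M := le_antisymm
    (sSup_le fun I hI => le_sup_left.trans (hM.le_of_ge (hI.sup hM.prop) le_sup_right))
    (le_sSup hM.prop)
  exact hradical ▸ hM.prop

theorem radical_quotient_radical : (L.quotient L.radical isIdeal_radical).radical = ⊥ := by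
  refine le_bot_iff.mp (sSup_le fun S hS => ?_)
  rw [← Submodule.map_comap_eq_of_surjective L.radical.mkQ_surjective S,
    Submodule.map_le_iff_le_comap, Submodule.comap_bot, Submodule.ker_mkQ]
  exact le_sSup (isSolvableIdeal_radical.comap_mkQ hS)

theorem exists_isIdeal_sup_eq_top (hn : 2 ≤ n) (hL : L.radical = ⊥) {P : Submodule ℂ g}
    (hP : L.IsIdeal P) (hP' : P ≠ ⊥) : ∃ K, L.IsIdeal K ∧ K ≠ ⊤ ∧ K ⊔ P = ⊤ := by
  obtain hbot | ⟨J, hJ, hJP⟩ := eq_bot_or_exists_atom_le hP.toLieSubmodule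
  · exact absurd (congrArg LieSubmodule.toSubmodule hbot) hP'
  obtain ⟨N, hN⟩ := exists_isCompl_of_isAtom hn hL hJ
  have hN' := LieSubmodule.isCompl_toSubmodule.mpr hN
  refine ⟨N, isIdeal_coe N, fun htop => hJ.ne_bot (J.toSubmodule_eq_bot.mp ?_), ?_⟩
  · rw [← inf_top_eq J.toSubmodule, ← htop, hN'.inf_eq_bot]
  · rw [eq_top_iff, ← hN'.sup_eq_top, sup_comm]
    exact sup_le_sup_left hJP _

theorem exists_isIdeal_sup_eq_top_of_not_le_radical (hn : 2 ≤ n) {P : Submodule ℂ g}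
    (hP : L.IsIdeal P) (hP' : ¬ P ≤ L.radical) :
    ∃ T, L.IsIdeal T ∧ L.radical ≤ T ∧ T ≠ ⊤ ∧ T ⊔ P = ⊤ := by
  set R := L.radical
  have hPR : P.map R.mkQ ≠ ⊥ := by
    rwa [Ne, ← le_bot_iff, Submodule.map_le_iff_le_comap, Submodule.comap_bot, Submodule.ker_mkQ]
  obtain ⟨K, hK, hKtop, hKP⟩ :=
    exists_isIdeal_sup_eq_top hn radical_quotient_radical (isIdeal_radical.map_mkQ hP) hPR
  have hmap : (K.comap R.mkQ).map R.mkQ = K :=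
    Submodule.map_comap_eq_of_surjective R.mkQ_surjective K
  refine ⟨K.comap R.mkQ, isIdeal_radical.comap_mkQ hK, R.le_comap_mkQ K, fun htop => hKtop ?_, ?_⟩
  · rw [← hmap, htop, Submodule.map_top, Submodule.range_mkQ]
  · rw [← sup_eq_right.mpr (R.le_comap_mkQ K), sup_assoc, ← Submodule.map_mkQ_eq_top,
      Submodule.map_sup, hmap, hKP]

end Radical

section DoubleBracket

variable {I A : Submodule ℂ g}

/-- The subspace `[A, A, g, …, g]`, a summand in the decomposition of `A = I^⊥ / I`. -/
def doubleBracket (L : NLieAlgebra n g) (A : Submodule ℂ g) : Submodule ℂ g :=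
  L.bracketSpan fun i => if (i : ℕ) < 2 then A else ⊤

theorem isIdeal_doubleBracket (hA : L.IsIdeal A) : L.IsIdeal (L.doubleBracket A) :=
  isIdeal_bracketSpan fun i => by
    split_ifs
    exacts [hA, isIdeal_top]

theorem IsIdeal.doubleBracket_le (hn : 0 < n) (hA : L.IsIdeal A) : L.doubleBracket A ≤ A :=
  hA.bracketSpan_le ⟨0, hn⟩ (by simp)

theorem doubleBracket_map_mkQ {hI : L.IsIdeal I} :
    (L.quotient I hI).doubleBracket (A.map I.mkQ) = (L.doubleBracket A).map I.mkQ := by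
  rw [doubleBracket, doubleBracket, ← bracketSpan_map_mkQ (hI := hI)]
  congr 1
  ext1 i
  split_ifs
  · rfl
  · rw [Submodule.map_top, Submodule.range_mkQ]

theorem bracket_mem_doubleBracket (hn : 2 ≤ n) {x : Fin n → g} {i j : Fin n} (hij : i ≠ j)
    (hi : x i ∈ A) (hj : x j ∈ A) : L.bracket x ∈ L.doubleBracket A := by
  have h01 : (⟨0, by omega⟩ : Fin n) ≠ ⟨1, by omega⟩ := by simp
  obtain ⟨σ, h0, h1⟩ := MulAction.is_two_pretransitive_iff.mp
    (Equiv.Perm.isMultiplyPretransitive (Fin n) 2) h01 hij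
  have hmem : L.bracket (x ∘ σ) ∈ L.doubleBracket A := by
    refine bracket_mem_bracketSpan fun ⟨k, hk⟩ => ?_
    match k with
    | 0 => simpa [← h0] using hi
    | 1 => simpa [← h1] using hj
    | k + 2 => simp
  rw [L.bracket.map_perm] at hmem
  rcases Int.units_eq_one_or (Equiv.Perm.sign σ) with hσ | hσ <;> simpa [hσ] using hmem

end DoubleBracket

section Metric

variable {B : LinearMap.BilinForm ℂ g} {I J : Submodule ℂ g}

theorem IsMetric.ad_left (hB : L.IsMetric B) (x : Fin n → g) (i : Fin n) (u w : g) :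
    B (L.ad x i u) w = -B u (L.ad x i w) := by
  rw [ad_apply, hB.invariant, ← ad_apply, hB.symm.eq]

theorem IsMetric.isIdeal_orthogonal (hB : L.IsMetric B) (hJ : L.IsIdeal J) :
    L.IsIdeal (B.orthogonal J) := by
  refine isIdeal_iff_ad.mpr fun x i v hv w hw => ?_
  rw [← neg_eq_zero, ← hB.ad_left]
  exact hv _ (isIdeal_iff_ad.mp hJ x i hw)

theorem IsMetric.bracket_eq_zero (hB : L.IsMetric B) (hJ : L.IsIdeal J) {x : Fin n → g}
    {i j : Fin n} (hij : i ≠ j) (hi : x i ∈ J) (hj : x j ∈ B.orthogonal J) :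
    L.bracket x = 0 := by
  refine hB.nondegenerate.1 _ fun z => ?_
  rw [← ad_apply_self x j, hB.ad_left, neg_eq_zero, hB.symm.eq]
  exact hj _ (hJ _ ⟨i, by simpa [hij] using hi⟩)

theorem IsMetric.orthogonal_le_comm (hB : L.IsMetric B) (h : I ≤ B.orthogonal J) :
    J ≤ B.orthogonal I :=
  (LinearMap.BilinForm.le_orthogonal_orthogonal hB.symm.isRefl).trans
    (LinearMap.BilinForm.orthogonal_le h)

theorem IsMetric.isIsotropicIdeal_inf_orthogonal (hB : L.IsMetric B) (hJ : L.IsIdeal J) :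
    L.IsIsotropicIdeal B (J ⊓ B.orthogonal J) :=
  ⟨hJ.inf (hB.isIdeal_orthogonal hJ),
    inf_le_right.trans (LinearMap.BilinForm.orthogonal_le inf_le_left)⟩

theorem IsIsotropicIdeal.sup (hB : L.IsMetric B) (hI : L.IsIsotropicIdeal B I)
    (hJ : L.IsIsotropicIdeal B J) (hIJ : I ≤ B.orthogonal J) : L.IsIsotropicIdeal B (I ⊔ J) := by
  refine ⟨hI.1.sup hJ.1, ?_⟩
  rw [orthogonal_sup]
  exact sup_le (le_inf hI.2 hIJ) (le_inf (hB.orthogonal_le_comm hIJ) hJ.2)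

theorem IsIsotropicIdeal.le_radical (hn : 2 ≤ n) (hB : L.IsMetric B)
    (hI : L.IsIsotropicIdeal B I) : I ≤ L.radical := by
  refine le_sSup ⟨hI.1, 1, eq_bot_iff.mpr (bracketSpan_le.mpr fun x hx => ?_)⟩
  exact hB.bracket_eq_zero hI.1 (i := ⟨0, by omega⟩) (j := ⟨1, by omega⟩) (by simp) (hx _)
    (hI.2 (hx _))

theorem IsIsomaximal.radical_inf_orthogonal_le (hn : 2 ≤ n) (hB : L.IsMetric B)
    (hI : L.IsIsomaximal B I) : L.radical ⊓ B.orthogonal L.radical ≤ I := by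
  have horth : L.radical ⊓ B.orthogonal L.radical ≤ B.orthogonal I :=
    inf_le_right.trans (LinearMap.BilinForm.orthogonal_le (hI.prop.le_radical hn hB))
  have hsup := (hB.isIsotropicIdeal_inf_orthogonal isIdeal_radical).sup hB hI.prop horth
  exact le_sup_left.trans (hI.le_of_ge hsup le_sup_right)

theorem IsIsomaximal.inf_orthogonal_eq (hB : L.IsMetric B) (hI : L.IsIsomaximal B I)
    (hJ : L.IsIdeal J) (hIJ : I ≤ J) (hJI : J ≤ B.orthogonal I) : J ⊓ B.orthogonal J = I :=
  (hI.eq_of_le (hB.isIsotropicIdeal_inf_orthogonal hJ)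
    (le_inf hIJ (hB.orthogonal_le_comm hJI))).symm

theorem isAbelianSubalgebra_map_mkQ {hI : L.IsIdeal I} (h : L.bracketSpan (fun _ => J) ≤ I) :
    (L.quotient I hI).IsAbelianSubalgebra (J.map I.mkQ) := by
  have hbot : (L.quotient I hI).bracketSpan (fun _ => J.map I.mkQ) = ⊥ := by
    rwa [bracketSpan_map_mkQ, ← le_bot_iff, Submodule.map_le_iff_le_comap, Submodule.comap_bot,
      Submodule.ker_mkQ]
  exact ⟨bracketSpan_le.mp (hbot.trans_le bot_le), hbot⟩

variable [FiniteDimensional ℂ g]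

theorem IsMetric.orthogonal_orthogonal (hB : L.IsMetric B) (W : Submodule ℂ g) :
    B.orthogonal (B.orthogonal W) = W :=
  LinearMap.BilinForm.orthogonal_orthogonal hB.nondegenerate hB.symm.isRefl W

theorem IsMetric.isDecomposable (hB : L.IsMetric B) (hJ : L.IsIdeal J) (hbot : J ≠ ⊥)
    (htop : J ≠ ⊤) (h : J ⊓ B.orthogonal J = ⊥) : L.IsDecomposable B := by
  refine ⟨J, B.orthogonal J, hJ, hB.isIdeal_orthogonal hJ, hbot, fun h0 => htop ?_, h, ?_, ?_⟩
  · rw [← hB.orthogonal_orthogonal J, h0, LinearMap.BilinForm.orthogonal_bot]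
  · rw [hB.orthogonal_orthogonal, inf_comm, h]
  · exact (LinearMap.BilinForm.isCompl_orthogonal_iff_disjoint hB.symm.isRefl).mpr
      (disjoint_iff.mpr h)

theorem IsMetric.orthogonal_radical_le_radical (hn : 2 ≤ n) (hB : L.IsMetric B)
    (hr : L.radical ≠ ⊥) (hdec : ¬ L.IsDecomposable B) :
    B.orthogonal L.radical ≤ L.radical := by
  by_contra hle
  obtain ⟨T, hT, hRT, htop, hsup⟩ :=
    exists_isIdeal_sup_eq_top_of_not_le_radical hn (hB.isIdeal_orthogonal isIdeal_radical) hle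
  have hinf : B.orthogonal T ⊓ L.radical = ⊥ := by
    rw [← hB.orthogonal_orthogonal L.radical, ← orthogonal_sup, hsup,
      LinearMap.BilinForm.orthogonal_top_eq_bot hB.nondegenerate]
  have hTT : T ⊓ B.orthogonal T ≤ L.radical :=
    (hB.isIsotropicIdeal_inf_orthogonal hT).le_radical hn hB
  exact hdec (hB.isDecomposable hT (ne_bot_of_le_ne_bot hr hRT) htop
    (eq_bot_iff.mpr (hinf ▸ le_inf inf_le_right hTT)))

theorem IsIsomaximal.orthogonal_le_radical (hn : 2 ≤ n) (hB : L.IsMetric B)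
    (hI : L.IsIsomaximal B I) (hr : L.radical ≠ ⊥) (hdec : ¬ L.IsDecomposable B) :
    B.orthogonal I ≤ L.radical := by
  have hle : B.orthogonal L.radical ≤ I := by
    rw [← inf_eq_right.mpr (hB.orthogonal_radical_le_radical hn hr hdec)]
    exact hI.radical_inf_orthogonal_le hn hB
  rw [← hB.orthogonal_orthogonal L.radical]
  exact LinearMap.BilinForm.orthogonal_le hle

theorem IsIsomaximal.sup_orthogonal_eq (hB : L.IsMetric B) (hI : L.IsIsomaximal B I)
    (hJ : L.IsIdeal J) (hIJ : I ≤ J) (hJI : J ≤ B.orthogonal I) :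
    J ⊔ B.orthogonal J = B.orthogonal I := by
  rw [← hB.orthogonal_orthogonal (J ⊔ B.orthogonal J), orthogonal_sup, hB.orthogonal_orthogonal,
    inf_comm, hI.inf_orthogonal_eq hB hJ hIJ hJI]

theorem IsIsomaximal.le_of_bracketSpan_le (hn : 0 < n) (hB : L.IsMetric B)
    (hI : L.IsIsomaximal B I) (hJ : L.IsIdeal J)
    (hJI : J ≤ L.bracketSpan fun _ => B.orthogonal I) (hJJ : L.bracketSpan (fun _ => J) ≤ I) :
    J ≤ I := by
  -- For `W = J + I` one has `I^⊥ = W + W^⊥`, so `[I^⊥, …, I^⊥] ⊆ [W, …, W] + W^⊥ ⊆ W^⊥`;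
  -- hence `J ⊆ W ∩ W^⊥ = I`.
  let W := J ⊔ I
  have hW : L.IsIdeal W := hJ.sup hI.prop.1
  have hWI : W ≤ B.orthogonal I :=
    sup_le (hJI.trans ((hB.isIdeal_orthogonal hI.prop.1).bracketSpan_le ⟨0, hn⟩ le_rfl)) hI.prop.2
  have hIW : I ≤ B.orthogonal W := hB.orthogonal_le_comm hWI
  have horth : L.bracketSpan (fun _ => B.orthogonal I) ≤ B.orthogonal W := calc
    _ = L.bracketSpan (fun _ => W ⊔ B.orthogonal W) := by
      rw [hI.sup_orthogonal_eq hB hW le_sup_right hWI]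
    _ ≤ L.bracketSpan (fun _ => W) ⊔ B.orthogonal W :=
      bracketSpan_sup_le (hB.isIdeal_orthogonal hW) _
    _ ≤ (L.bracketSpan (fun _ => J) ⊔ I) ⊔ B.orthogonal W :=
      sup_le_sup_right (bracketSpan_sup_le hI.prop.1 _) _
    _ ≤ B.orthogonal W := sup_le (sup_le (hJJ.trans hIW) hIW) le_rfl
  rw [← hI.inf_orthogonal_eq hB hW le_sup_right hWI]
  exact le_inf le_sup_left (hJI.trans horth)

theorem IsIsomaximal.bracketSpan_orthogonal_le (hn : 0 < n) (hB : L.IsMetric B)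
    (hI : L.IsIsomaximal B I) (hr : B.orthogonal I ≤ L.radical) :
    L.bracketSpan (fun _ => B.orthogonal I) ≤ I := by
  have hO := hB.isIdeal_orthogonal hI.prop.1
  have hanti := derivedSeries_antitone hn hO
  have descent (s : ℕ) (hs : L.derivedSeries (B.orthogonal I) (s + 1) ≤ I) :
      L.derivedSeries (B.orthogonal I) 1 ≤ I := by
    induction s with
    | zero => exact hs
    | succ s ih =>
      exact ih (hI.le_of_bracketSpan_le hn hB (isIdeal_derivedSeries hO _)
        (hanti (Nat.le_add_left 1 s)) hs)
  obtain ⟨s, hs⟩ := (isSolvableIdeal_radical (L := L)).2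
  refine descent s ((hanti s.le_succ).trans ((derivedSeries_mono hr s).trans ?_))
  rw [hs]
  exact bot_le

theorem IsMetric.mkQ_mem_centralizer_iff (hn : 2 ≤ n) (hB : L.IsMetric B) {hI : L.IsIdeal I}
    {x : g} : I.mkQ x ∈ (L.quotient I hI).centralizer ((B.orthogonal I).map I.mkQ) ↔
      x ∈ B.orthogonal (L.doubleBracket (B.orthogonal I)) := by
  rw [NLieAlgebra.mkQ_mem_centralizer_iff]
  refine ⟨fun hx => ?_, fun hx y i j hij hy => ?_⟩
  · suffices L.doubleBracket (B.orthogonal I) ≤ LinearMap.ker (B.flip x) from this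
    refine bracketSpan_le.mpr fun y hy => ?_
    have h0 : y ⟨0, by omega⟩ ∈ B.orthogonal I := by simpa using hy ⟨0, by omega⟩
    have h1 : y ⟨1, by omega⟩ ∈ B.orthogonal I := by simpa using hy ⟨1, by omega⟩
    change B (L.bracket y) x = 0
    rw [← ad_apply_self y ⟨0, by omega⟩, hB.ad_left, neg_eq_zero, hB.symm.eq]
    exact h0 _ (hx y _ _ (by simp) h1)
  · rw [← hB.orthogonal_orthogonal I]
    intro z hz
    rw [← neg_eq_zero, ← hB.ad_left]
    exact hx _ (bracket_mem_doubleBracket hn hij (by simpa using hz) (by simpa [hij.symm] using hy))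

theorem IsMetric.centralizer_inf_map_orthogonal (hn : 2 ≤ n) (hB : L.IsMetric B)
    (hI : L.IsIdeal I) :
    (L.quotient I hI).centralizer ((B.orthogonal I).map I.mkQ) ⊓ (B.orthogonal I).map I.mkQ =
      (B.orthogonal (L.doubleBracket (B.orthogonal I) ⊔ I)).map I.mkQ := by
  rw [orthogonal_sup]
  refine le_antisymm ?_ ?_
  · rintro _ ⟨hx, x, hxI, rfl⟩
    exact Submodule.mem_map_of_mem ⟨(hB.mkQ_mem_centralizer_iff hn).mp hx, hxI⟩
  · rintro _ ⟨x, ⟨hx, hxI⟩, rfl⟩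
    exact ⟨(hB.mkQ_mem_centralizer_iff hn).mpr hx, Submodule.mem_map_of_mem hxI⟩

end Metric

end NLieAlgebra

open NLieAlgebra

theorem theorem3p4 {n : ℕ} (hn : 2 ≤ n) {g : Type*} [AddCommGroup g] [Module ℂ g]
    [FiniteDimensional ℂ g] (L : NLieAlgebra n g) (B : LinearMap.BilinForm ℂ g)
    (hB : L.IsMetric B) (hr : L.radical ≠ ⊥)
    (I : Submodule ℂ g) (hI : L.IsIsomaximal B I) :
    (L.radical ⊓ B.orthogonal L.radical ≤ I ∧ I ≤ L.radical) ∧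
    (¬ L.IsDecomposable B →
      -- `I^⊥ ⊆ r`
      B.orthogonal I ≤ L.radical ∧
      -- `A := I^⊥ / I` is an abelian subalgebra of `g / I`
      (L.quotient I hI.prop.1).IsAbelianSubalgebra ((B.orthogonal I).map I.mkQ) ∧
      -- `A = [A, A, g / I, …, g / I] ⊕ (C_{g / I}(A) ∩ A)`
      ((L.quotient I hI.prop.1).bracketSpan
            (fun i => if (i : ℕ) < 2 then (B.orthogonal I).map I.mkQ else ⊤) ⊔
          ((L.quotient I hI.prop.1).centralizer ((B.orthogonal I).map I.mkQ) ⊓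
            (B.orthogonal I).map I.mkQ) =
          (B.orthogonal I).map I.mkQ ∧
        Disjoint
          ((L.quotient I hI.prop.1).bracketSpan
            (fun i => if (i : ℕ) < 2 then (B.orthogonal I).map I.mkQ else ⊤))
          ((L.quotient I hI.prop.1).centralizer ((B.orthogonal I).map I.mkQ) ⊓
            (B.orthogonal I).map I.mkQ))) := by
  have hII := hI.prop.1
  have hO := hB.isIdeal_orthogonal hII
  refine ⟨⟨hI.radical_inf_orthogonal_le hn hB, hI.prop.le_radical hn hB⟩, fun hdec => ?_⟩
  have hOr := hI.orthogonal_le_radical hn hB hr hdec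
  refine ⟨hOr, isAbelianSubalgebra_map_mkQ (hI.bracketSpan_orthogonal_le (by omega) hB hOr), ?_⟩
  let J := L.doubleBracket (B.orthogonal I) ⊔ I
  have hJ : L.IsIdeal J := (isIdeal_doubleBracket hO).sup hII
  have hIJ : I ≤ J := le_sup_right
  have hJI : J ≤ B.orthogonal I := sup_le (hO.doubleBracket_le (by omega)) hI.prop.2
  let Q := L.quotient I hII
  change Q.doubleBracket _ ⊔ _ = _ ∧ Disjoint (Q.doubleBracket _) _
  have hmap : Q.doubleBracket ((B.orthogonal I).map I.mkQ) = J.map I.mkQ := by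
    rw [doubleBracket_map_mkQ, Submodule.map_sup, Submodule.mkQ_map_self, sup_bot_eq]
  rw [hmap, hB.centralizer_inf_map_orthogonal hn hII]
  refine ⟨?_, disjoint_map_mkQ (hB.orthogonal_le_comm hJI) (hI.inf_orthogonal_eq hB hJ hIJ hJI).le⟩
  rw [← Submodule.map_sup, hI.sup_orthogonal_eq hB hJ hIJ hJI]
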